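/- For a graph $G$ on $n$ vertices, let $\varrho_k(G)$ be the number of copies of $K_k$ in $G$ divided by $\binom{n}{k}$. The incomparability graph of a partially ordered set has the elements of the poset as vertices, two of them being adjacent if and only if they are incomparable. Write $K_k[t]$ for the complete $k$-partite graph with all $k$ parts of size $t$. Let $c\in(0,\tfrac12)$ and let $k\ge 2$ be an integer. There is an $n_0=n_0(c,k)$ such that for every $n\ge n_0$, every $n$-vertex incomparability graph $G$ with $\varrho_k(G)\ge c$ contains, as a (not necessarily induced) subgraph, a copy of $K_k[t]$ with $$t=\left\lceil\frac{c^4\,n}{10^8\,k^2\log n}\right\rceil ,$$ where $\log$ is the natural logarithm. -/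

import Mathlib

/-- The incomparability graph of a partially ordered set: the vertices are the elements of the
poset, and two vertices are adjacent if and only if they are incomparable. -/
def incomparabilityGraph (P : Type*) [PartialOrder P] : SimpleGraph P where
  Adj a b := IncompRel (· ≤ ·) a b
  symm := ⟨fun _ _ h => ⟨h.2, h.1⟩⟩
  loopless := ⟨fun _ h => h.1 le_rfl⟩

/-- A graph is an incomparability graph if it is the incomparability graph of some partial order
on its vertex set. -/
def IsIncomparabilityGraph {V : Type*} (G : SimpleGraph V) : Prop :=
  ∃ _ : PartialOrder V, G = incomparabilityGraph V

/-- The `K_k`-density of a finite graph: the number of copies of `K_k` (that is, of `k`-element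
vertex sets that are cliques) divided by the binomial coefficient `|V|` choose `k`. -/
noncomputable def cliqueDensity {V : Type*} (k : ℕ) (G : SimpleGraph V) : ℝ :=
  ((G.cliqueSet k).ncard : ℝ) / ((Nat.card V).choose k : ℝ)

/-- The `t`-blowup `H[t]` of a graph `H`: every vertex is replaced by an independent set of size
`t`, and every edge by a complete bipartite graph `K_{t,t}`. -/
def blowup {W : Type*} (H : SimpleGraph W) (t : ℕ) : SimpleGraph (W × Fin t) :=
  H.comap Prod.fst

/-! ### Families of pairwise incomparable sets and how to find them -/

section Incomparable

open Finset
open scoped Classical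

variable {V : Type*} [PartialOrder V]

/-! Suppose there is no family of `k` pairwise incomparable sets of size `t`. The basic tool
(`card_le_of_upIn_card_le`) says that a set in which every element has at most `2 ^ L` elements
above it has size of order at most `k * t * L + k * 2 ^ L`. It is proved by halving the bound on
up-sets `L` times, each time deleting few elements. The `log n` in the theorem is the number of
halvings.

If `c ^ 2 * k ^ 3 ≤ 10 ^ 5`, take a linear extension and cut it into blocks of length about `c * n /
(4 * k ^ 2)`. By the basic tool few elements have a small up-set inside their own block. If `v` is
not such an element, that up-set is a first part, incomparable to every later-block element that is
incomparable to `v`; so those neighbours of `v` contain no family with one part fewer. Induction on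
the clique size bounds the number of `k`-cliques and contradicts the density.

If `c ^ 2 * k ^ 3 > 10 ^ 5`, many `k`-cliques force a set `Q` of at least `n / 16` elements, each
comparable to only about a `1 / (4 * k)` fraction of `Q`; otherwise peeling off vertices of low
degree would bound the number of cliques too well. The basic tool and its dual give an interval `[x,
y]` with at least `t` elements in every large subset. An element incomparable to `x` and to `y` is
incomparable to the whole interval, so `k` intervals can be chosen greedily. -/

/-- `R` contains `k` sets of size at least `t` such that elements of different sets are
incomparable. -/
def HasIncomparableFamily (k t : ℕ) (R : Finset V) : Prop :=
  ∃ A : Fin k → Finset V, (∀ i, A i ⊆ R ∧ t ≤ #(A i)) ∧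
    ∀ i j, i ≠ j → ∀ a ∈ A i, ∀ b ∈ A j, ¬ a ≤ b

theorem HasIncomparableFamily.mono {k t : ℕ} {R S : Finset V} (h : HasIncomparableFamily k t R)
    (hRS : R ⊆ S) : HasIncomparableFamily k t S := by
  obtain ⟨A, hA, hinc⟩ := h
  exact ⟨A, fun i => ⟨(hA i).1.trans hRS, (hA i).2⟩, hinc⟩

theorem hasIncomparableFamily_zero (t : ℕ) (R : Finset V) : HasIncomparableFamily 0 t R :=
  ⟨fun i => i.elim0, fun i => i.elim0, fun i => i.elim0⟩

theorem HasIncomparableFamily.cons {k t : ℕ} {A₀ R S : Finset V}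
    (h : HasIncomparableFamily k t S) (hS : S ⊆ R) (hA₀ : A₀ ⊆ R) (ht : t ≤ #A₀)
    (hinc : ∀ a ∈ A₀, ∀ b ∈ S, ¬ a ≤ b ∧ ¬ b ≤ a) : HasIncomparableFamily (k + 1) t R := by
  obtain ⟨A, hA, hAA⟩ := h
  refine ⟨Fin.cons A₀ A, ?_, ?_⟩
  · intro i
    refine Fin.cases ?_ (fun i => ?_) i
    · simpa using ⟨hA₀, ht⟩
    · simpa using ⟨(hA i).1.trans hS, (hA i).2⟩
  · intro i j
    refine Fin.cases ?_ (fun i => ?_) i <;> refine Fin.cases ?_ (fun j => ?_) j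
    · simp
    · intro _ a ha b hb
      simp only [Fin.cons_zero, Fin.cons_succ] at ha hb
      exact (hinc a ha b ((hA j).1 hb)).1
    · intro _ a ha b hb
      simp only [Fin.cons_zero, Fin.cons_succ] at ha hb
      exact (hinc b hb a ((hA i).1 ha)).2
    · intro hij a ha b hb
      simp only [Fin.cons_succ] at ha hb
      exact hAA i j (by simpa using hij) a ha b hb

theorem HasIncomparableFamily.of_dual {k t : ℕ} {R : Finset V}
    (h : HasIncomparableFamily (V := Vᵒᵈ) k t R) : HasIncomparableFamily k t R := by
  obtain ⟨A, hA, hinc⟩ := h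
  exact ⟨A, hA, fun i j hij a ha b hb => hinc j i hij.symm b hb a ha⟩

theorem HasIncomparableFamily.isContained [Fintype V] {k t : ℕ} {R : Finset V}
    (h : HasIncomparableFamily k t R) :
    (blowup (SimpleGraph.completeGraph (Fin k)) t).IsContained (incomparabilityGraph V) := by
  obtain ⟨A, hA, hinc⟩ := h
  have hemb : ∀ i, Nonempty (Fin t ↪ A i) := fun i =>
    Function.Embedding.nonempty_of_card_le (by simpa using (hA i).2)
  let e : ∀ i, Fin t ↪ A i := fun i => (hemb i).some
  refine ⟨⟨⟨fun p => (e p.1 p.2 : V), ?_⟩, ?_⟩⟩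
  · intro p q hpq
    have hne : p.1 ≠ q.1 := by
      simpa [blowup, SimpleGraph.completeGraph] using hpq
    exact ⟨hinc _ _ hne _ (e p.1 p.2).2 _ (e q.1 q.2).2,
      hinc _ _ hne.symm _ (e q.1 q.2).2 _ (e p.1 p.2).2⟩
  · rintro ⟨i, a⟩ ⟨j, b⟩ hab
    have hab' : (e i a : V) = e j b := hab
    by_cases hij : i = j
    · subst hij
      rw [(e i).injective (Subtype.ext hab')]
    · exact absurd hab'.le (hinc _ _ hij _ (e i a).2 _ (e j b).2)

/-! ### Up-sets, private elements and large intervals -/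

/-- The elements of `Q` above `x`. -/
noncomputable def upIn (Q : Finset V) (x : V) : Finset V := {y ∈ Q | x ≤ y}

theorem mem_upIn {Q : Finset V} {x y : V} : y ∈ upIn Q x ↔ y ∈ Q ∧ x ≤ y := by
  simp [upIn]

/-- If `a ∈ F x`, `b ∈ F x'` and `a ≤ b`, then `x ≤ a ≤ b`, against privacy of `b`. So the sets `F
x` are pairwise incomparable, and unions of `g` of them form the `k` parts. -/
theorem hasIncomparableFamily_of_private {k g s t : ℕ} {R I : Finset V} (F : V → Finset V)
    (hFR : ∀ x ∈ I, F x ⊆ R) (hF : ∀ x ∈ I, ∀ y ∈ F x, x ≤ y) (hs : ∀ x ∈ I, s ≤ #(F x))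
    (hpriv : ∀ x ∈ I, ∀ x' ∈ I, x ≠ x' → ∀ y ∈ F x, ¬ x' ≤ y)
    (hI : k * g ≤ #I) (ht : t ≤ g * s) : HasIncomparableFamily k t R := by
  have hemb : Nonempty (Fin k × Fin g ↪ I) :=
    Function.Embedding.nonempty_of_card_le (by simpa using hI)
  obtain ⟨e⟩ := hemb
  refine ⟨fun i => univ.biUnion fun m => F (e (i, m)), fun i => ⟨?_, ?_⟩, ?_⟩
  · exact biUnion_subset.2 fun m _ => hFR _ (e (i, m)).2
  · rw [card_biUnion]
    · calc t ≤ g * s := ht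
        _ = ∑ _m : Fin g, s := by simp
        _ ≤ _ := sum_le_sum fun m _ => hs _ (e (i, m)).2
    · intro m _ m' _ hmm
      refine Finset.disjoint_left.2 fun y hy hy' => ?_
      refine hpriv _ (e (i, m)).2 _ (e (i, m')).2 ?_ y hy (hF _ (e (i, m')).2 y hy')
      intro h
      exact hmm (by simpa using e.injective (Subtype.ext h))
  · intro i j hij a ha b hb hab
    simp only [mem_biUnion, mem_univ, true_and] at ha hb
    obtain ⟨m, hm⟩ := ha
    obtain ⟨m', hm'⟩ := hb
    refine hpriv _ (e (j, m')).2 _ (e (i, m)).2 ?_ b hm' ((hF _ (e (i, m)).2 a hm).trans hab)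
    intro h
    have := e.injective (Subtype.ext h)
    simp only [Prod.mk.injEq] at this
    exact hij this.1.symm

/-- Choose `I` maximizing the size of the union of up-sets minus `s * #I`. Adding a point cannot
help, so no up-set has more than `s` uncovered elements; removing a point cannot help, so each point
of `I` covers at least `s` elements alone. -/
theorem exists_private_cover (Q : Finset V) (s : ℕ) :
    ∃ I ⊆ Q, (∀ x ∈ Q, #(upIn Q x \ I.biUnion (upIn Q)) ≤ s) ∧
      ∀ x ∈ I, s ≤ #(upIn Q x \ (I.erase x).biUnion (upIn Q)) := by
  obtain ⟨I, hI, hmax⟩ := exists_max_image Q.powerset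
    (fun I => (#(I.biUnion (upIn Q)) : ℤ) - s * #I) ⟨∅, by simp⟩
  rw [mem_powerset] at hI
  refine ⟨I, hI, fun x hx => ?_, fun x hx => ?_⟩
  · by_cases hxI : x ∈ I
    · rw [sdiff_eq_empty_iff_subset.2 (subset_biUnion_of_mem _ hxI)]
      simp
    · have h := hmax (insert x I) (mem_powerset.2 (insert_subset hx hI))
      rw [biUnion_insert, card_insert_of_notMem hxI, ← card_sdiff_add_card] at h
      push_cast at h
      have : ((#(upIn Q x \ I.biUnion (upIn Q)) : ℕ) : ℤ) ≤ s := by linarith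
      exact_mod_cast this
  · have h := hmax (I.erase x) (mem_powerset.2 ((erase_subset _ _).trans hI))
    have h1 : #(I.biUnion (upIn Q)) =
        #(upIn Q x \ (I.erase x).biUnion (upIn Q)) + #((I.erase x).biUnion (upIn Q)) := by
      conv_lhs => rw [← insert_erase hx, biUnion_insert]
      rw [card_sdiff_add_card]
    have h2 : #I = #(I.erase x) + 1 := (card_erase_add_one hx).symm
    rw [h1, h2] at h
    push_cast at h
    have : (s : ℤ) ≤ (#(upIn Q x \ (I.erase x).biUnion (upIn Q)) : ℕ) := by linarith
    exact_mod_cast this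

/-- The points of `I` have private sets of size at least `s`, so without a family `I` is small. Its
union `Z` of up-sets is then small, and deleting `Z` leaves only the uncovered part of each up-set.
-/
theorem exists_halve_upIn {k s t : ℕ} {Q : Finset V} (hs : 0 < s)
    (hfree : ¬ HasIncomparableFamily k t Q) (hQ : ∀ x ∈ Q, #(upIn Q x) ≤ 2 * s) :
    ∃ Q' ⊆ Q, #Q ≤ #Q' + 2 * k * (t + s) ∧ ∀ x ∈ Q', #(upIn Q' x) ≤ s := by
  obtain ⟨I, hIQ, hcov, hpriv⟩ := exists_private_cover Q s
  set Z := I.biUnion (upIn Q) with hZ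
  have hgs : t ≤ (t / s + 1) * s := by
    have := Nat.lt_div_mul_add (a := t) hs
    linarith
  have hI : #I < k * (t / s + 1) := by
    by_contra! hI
    refine hfree (hasIncomparableFamily_of_private
      (fun x => upIn Q x \ (I.erase x).biUnion (upIn Q)) ?_ ?_ hpriv ?_ hI hgs)
    · exact fun x _ => sdiff_subset.trans (filter_subset _ _)
    · exact fun x _ y hy => (mem_upIn.1 (mem_sdiff.1 hy).1).2
    · intro x hx x' hx' hne y hy hle
      obtain ⟨hy1, hy2⟩ := mem_sdiff.1 hy
      exact hy2 (mem_biUnion.2 ⟨x', mem_erase.2 ⟨hne.symm, hx'⟩,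
        mem_upIn.2 ⟨(mem_upIn.1 hy1).1, hle⟩⟩)
  have hZc : #Z ≤ 2 * k * (t + s) := by
    calc #Z ≤ #I * (2 * s) := card_biUnion_le_card_mul _ _ _ fun x hx => hQ x (hIQ hx)
      _ ≤ k * (t / s + 1) * (2 * s) := Nat.mul_le_mul_right _ hI.le
      _ = 2 * k * (t / s * s + s) := by ring
      _ ≤ 2 * k * (t + s) := by
        gcongr
        exact Nat.div_mul_le_self t s
  refine ⟨Q \ Z, sdiff_subset, ?_, ?_⟩
  · have := le_card_sdiff Z Q
    omega
  · intro x hx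
    refine (card_le_card ?_).trans (hcov x (mem_sdiff.1 hx).1)
    intro y hy
    obtain ⟨hy1, hy2⟩ := mem_upIn.1 hy
    obtain ⟨hy3, hy4⟩ := mem_sdiff.1 hy1
    exact mem_sdiff.2 ⟨mem_upIn.2 ⟨hy3, hy2⟩, hy4⟩

theorem card_le_of_upIn_card_le {k t : ℕ} (L : ℕ) {Q : Finset V}
    (hfree : ¬ HasIncomparableFamily k t Q) (hQ : ∀ x ∈ Q, #(upIn Q x) ≤ 2 ^ L) :
    #Q ≤ 2 * k * t * L + 2 * k * 2 ^ L + k * t := by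
  induction L generalizing Q with
  | zero =>
    -- Up-sets of size one make `Q` an antichain, so singletons are private sets.
    by_contra! h
    refine hfree (hasIncomparableFamily_of_private (I := Q) (g := t) (s := 1) (fun x => {x})
      ?_ ?_ ?_ ?_ ?_ ?_)
    · simp
    · simp
    · simp
    · intro x hx x' hx' hne y hy hle
      rw [mem_singleton] at hy
      subst hy
      exact hne (card_le_one.1 (by simpa using hQ x' hx') y (mem_upIn.2 ⟨hx, hle⟩) x'
        (mem_upIn.2 ⟨hx', le_rfl⟩))
    · omega
    · simp
  | succ L ih =>
    obtain ⟨Q', hQ'Q, hcard, hQ'⟩ := exists_halve_upIn (s := 2 ^ L) (by positivity) hfree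
      (by simpa [pow_succ, mul_comm] using hQ)
    have := ih (fun h => hfree (h.mono hQ'Q)) hQ'
    calc #Q ≤ #Q' + 2 * k * (t + 2 ^ L) := hcard
      _ ≤ 2 * k * t * L + 2 * k * 2 ^ L + k * t + 2 * k * (t + 2 ^ L) := by gcongr
      _ = _ := by ring

theorem card_le_of_card_filter_le {k t : ℕ} (L : ℕ) {Q : Finset V}
    (hfree : ¬ HasIncomparableFamily k t Q) (hQ : ∀ y ∈ Q, #{z ∈ Q | z ≤ y} ≤ 2 ^ L) :
    #Q ≤ 2 * k * t * L + 2 * k * 2 ^ L + k * t :=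
  card_le_of_upIn_card_le (V := Vᵒᵈ) (Q := Q) L (fun h => hfree h.of_dual) hQ

/-- Some `x` has a large up-set; applied inside that up-set, the dual bound gives a `y` with many
elements of the up-set below it. -/
theorem exists_large_interval {k t L₁ L₂ : ℕ} {Q : Finset V}
    (hfree : ¬ HasIncomparableFamily k t Q)
    (hL : 2 * k * t * L₁ + 2 * k * 2 ^ L₁ + k * t ≤ 2 ^ L₂)
    (hQ : 2 * k * t * L₂ + 2 * k * 2 ^ L₂ + k * t < #Q) :
    ∃ x ∈ Q, ∃ y ∈ Q, 2 ^ L₁ < #{z ∈ Q | x ≤ z ∧ z ≤ y} := by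
  obtain ⟨x, hx, hxU⟩ : ∃ x ∈ Q, 2 ^ L₂ < #(upIn Q x) := by
    by_contra! h
    exact absurd (card_le_of_upIn_card_le L₂ hfree h) (by omega)
  obtain ⟨y, hy, hyD⟩ : ∃ y ∈ upIn Q x, 2 ^ L₁ < #{z ∈ upIn Q x | z ≤ y} := by
    by_contra! h
    have := card_le_of_card_filter_le (Q := upIn Q x) L₁
      (fun hf => hfree (hf.mono (filter_subset _ _))) h
    omega
  refine ⟨x, hx, y, (mem_upIn.1 hy).1, hyD.trans_le (card_le_card ?_)⟩
  intro z hz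
  simp only [mem_filter, mem_upIn] at hz ⊢
  exact ⟨hz.1.1, hz.1.2, hz.2⟩

/-- Greedy selection of intervals: if every large part of `Q` contains a large interval and every
element of `Q` is comparable to few others, then `Q` contains an incomparable family. -/
theorem hasIncomparableFamily_of_intervals {m d t : ℕ} {Q : Finset V}
    (hint : ∀ S ⊆ Q, m ≤ #S → ∃ x ∈ S, ∃ y ∈ S, t ≤ #{z ∈ S | x ≤ z ∧ z ≤ y})
    (hdeg : ∀ x ∈ Q, #{y ∈ Q | x ≤ y ∨ y ≤ x} ≤ d) (r : ℕ) {S : Finset V} (hS : S ⊆ Q)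
    (hcard : m + r * (2 * d) ≤ #S) : HasIncomparableFamily r t S := by
  induction r generalizing S with
  | zero => exact hasIncomparableFamily_zero t S
  | succ r ih =>
    obtain ⟨x, hx, y, hy, hxy⟩ := hint S hS (by omega)
    -- Outside `C` everything is incomparable to both endpoints, hence to the interval.
    set C := {z ∈ Q | x ≤ z ∨ z ≤ x} ∪ {z ∈ Q | y ≤ z ∨ z ≤ y} with hC
    have hCc : #C ≤ 2 * d := by
      have h1 := hdeg x (hS hx)
      have h2 := hdeg y (hS hy)
      calc #C ≤ _ := card_union_le _ _
        _ ≤ d + d := by gcongr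
        _ = 2 * d := by ring
    have hrest : HasIncomparableFamily r t (S \ C) := by
      refine ih (sdiff_subset.trans hS) ?_
      have := le_card_sdiff C S
      rw [add_mul] at hcard
      omega
    refine hrest.cons sdiff_subset (filter_subset (fun z => x ≤ z ∧ z ≤ y) S) hxy ?_
    intro a ha b hb
    obtain ⟨-, hxa, hay⟩ := mem_filter.1 ha
    obtain ⟨hbS, hbC⟩ := mem_sdiff.1 hb
    simp only [hC, mem_union, mem_filter, hS hbS, true_and, not_or] at hbC
    exact ⟨fun h => hbC.1.1 (hxa.trans h), fun h => hbC.2.2 (h.trans hay)⟩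

end Incomparable

/-! ### Counting cliques by removing vertices -/

section CliqueCount

open Finset
open scoped Classical Nat

/-- The increment needed in inductions that remove one vertex: a bound of order `z ^ j` on the
cliques through it sums to `z ^ (j + 1)`. -/
theorem pow_succ_add_mul_pow_le {R : Type*} [CommSemiring R] [LinearOrder R]
    [IsStrictOrderedRing R] {z : R} (hz : 0 ≤ z) (j : ℕ) :
    z ^ (j + 1) + (j + 1) * z ^ j ≤ (z + 1) ^ (j + 1) := by
  induction j with
  | zero => simp
  | succ j ih =>
    calc z ^ (j + 1 + 1) + ((j + 1 : ℕ) + 1) * z ^ (j + 1)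
        ≤ z ^ (j + 1 + 1) + ((j + 1 : ℕ) + 1) * z ^ (j + 1) + (j + 1) * z ^ j :=
          le_add_of_nonneg_right (by positivity)
      _ = (z ^ (j + 1) + (j + 1) * z ^ j) * (z + 1) := by push_cast; ring
      _ ≤ (z + 1) ^ (j + 1) * (z + 1) := by gcongr
      _ = (z + 1) ^ (j + 1 + 1) := (pow_succ _ _).symm

variable {V : Type*}

/-- The number of `j`-cliques of `G` inside `Q`. -/
noncomputable def cliqueCount (G : SimpleGraph V) (j : ℕ) (Q : Finset V) : ℕ :=
  #((Q.powersetCard j).filter fun S : Finset V => G.IsClique (S : Set V))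

variable (G : SimpleGraph V)

theorem factorial_mul_cliqueCount_le (j : ℕ) (Q : Finset V) :
    j ! * cliqueCount G j Q ≤ #Q ^ j := by
  calc j ! * cliqueCount G j Q ≤ j ! * (#Q).choose j := by
        gcongr
        exact (card_filter_le _ _).trans (card_powersetCard j Q).le
    _ = (#Q).descFactorial j := (Nat.descFactorial_eq_factorial_mul_choose _ _).symm
    _ ≤ #Q ^ j := Nat.descFactorial_le_pow _ _

theorem cliqueCount_succ_le (j : ℕ) (Q : Finset V) (v : V) :
    cliqueCount G (j + 1) Q ≤
      cliqueCount G (j + 1) (Q.erase v) + cliqueCount G j {u ∈ Q | G.Adj v u} := by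
  have hsub : ((Q.powersetCard (j + 1)).filter fun S : Finset V => G.IsClique (S : Set V)) ⊆
      ((Q.erase v).powersetCard (j + 1)).filter (fun S : Finset V => G.IsClique (S : Set V)) ∪
        image (insert v)
          (({u ∈ Q | G.Adj v u} : Finset V).powersetCard j |>.filter
            fun S : Finset V => G.IsClique (S : Set V)) := by
    intro S hS
    simp only [mem_filter, mem_powersetCard] at hS
    obtain ⟨⟨hSQ, hSc⟩, hcl⟩ := hS
    by_cases hv : v ∈ S
    · refine mem_union_right _ (mem_image.2 ⟨S.erase v, ?_, insert_erase hv⟩)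
      simp only [mem_filter, mem_powersetCard]
      refine ⟨⟨fun u hu => ?_, by rw [card_erase_of_mem hv, hSc]; rfl⟩, hcl.subset (by simp)⟩
      obtain ⟨hne, huS⟩ := mem_erase.1 hu
      exact mem_filter.2 ⟨hSQ huS, hcl hv huS hne.symm⟩
    · refine mem_union_left _ ?_
      simp only [mem_filter, mem_powersetCard]
      exact ⟨⟨fun u hu => mem_erase.2 ⟨fun h => hv (h ▸ hu), hSQ hu⟩, hSc⟩, hcl⟩
  calc cliqueCount G (j + 1) Q ≤ _ := card_le_card hsub
    _ ≤ _ := card_union_le _ _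
    _ ≤ _ := Nat.add_le_add_left card_image_le _

theorem factorial_mul_cliqueCount_succ_le_sdiff (i : ℕ) (T W : Finset V) :
    (i + 1)! * cliqueCount G (i + 1) T ≤
      (i + 1)! * cliqueCount G (i + 1) (T \ W) + (i + 1) * (#W * #T ^ i) := by
  induction W using Finset.induction with
  | empty => simp
  | insert u W hu ih =>
    have h1 := cliqueCount_succ_le G i (T \ W) u
    have h2 : i ! * cliqueCount G i {x ∈ T \ W | G.Adj u x} ≤ #T ^ i :=
      (factorial_mul_cliqueCount_le G i _).trans
        (Nat.pow_le_pow_left (card_le_card ((filter_subset _ _).trans sdiff_subset)) _)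
    have h3 : T \ insert u W = (T \ W).erase u := by
      ext x; simp only [mem_sdiff, mem_insert, mem_erase]; tauto
    rw [h3, card_insert_of_notMem hu]
    calc (i + 1)! * cliqueCount G (i + 1) T
        ≤ (i + 1)! * cliqueCount G (i + 1) (T \ W) + (i + 1) * (#W * #T ^ i) := ih
      _ ≤ (i + 1)! * (cliqueCount G (i + 1) ((T \ W).erase u) +
            cliqueCount G i {x ∈ T \ W | G.Adj u x}) + (i + 1) * (#W * #T ^ i) := by gcongr
      _ = (i + 1)! * cliqueCount G (i + 1) ((T \ W).erase u) +
            (i + 1) * (i ! * cliqueCount G i {x ∈ T \ W | G.Adj u x}) +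
            (i + 1) * (#W * #T ^ i) := by rw [Nat.factorial_succ]; ring
      _ ≤ (i + 1)! * cliqueCount G (i + 1) ((T \ W).erase u) +
            (i + 1) * #T ^ i + (i + 1) * (#W * #T ^ i) := by gcongr
      _ = _ := by ring

/-- If every large vertex set has a vertex with a noticeable proportion of non-neighbours, then
there are few cliques. -/
theorem factorial_mul_cliqueCount_le_of_exists_low_degree {n δ α : ℝ} (hn : 0 ≤ n) (hδ : 0 ≤ δ)
    (hδ1 : δ ≤ 1) (hα : 0 ≤ α) (hα1 : α ≤ 1)
    (h : ∀ Q : Finset V, Q.Nonempty → δ * n ≤ #Q →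
      ∃ v ∈ Q, (#{u ∈ Q | G.Adj v u} : ℝ) ≤ α * (#Q - 1))
    (j₀ r : ℕ) (Q : Finset V) :
    ((j₀ + r)! : ℝ) * cliqueCount G (j₀ + r) Q ≤
      α ^ (j₀ * r) * (#Q : ℝ) ^ (j₀ + r) + δ ^ j₀ * (#Q + n) ^ (j₀ + r) := by
  induction r generalizing Q with
  | zero =>
    have h1 : ((j₀ ! * cliqueCount G j₀ Q : ℕ) : ℝ) ≤ ((#Q ^ j₀ : ℕ) : ℝ) := by
      exact_mod_cast factorial_mul_cliqueCount_le G j₀ Q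
    push_cast at h1
    have h2 : 0 ≤ δ ^ j₀ * (#Q + n) ^ j₀ := by positivity
    simpa using h1.trans (le_add_of_nonneg_right h2)
  | succ r ih =>
    induction hc : #Q generalizing Q with
    | zero =>
      have : Q = ∅ := card_eq_zero.1 hc
      subst this
      have : cliqueCount G (j₀ + (r + 1)) ∅ = 0 := by
        rw [cliqueCount, ← add_assoc, powersetCard_eq_empty.2 (by simp)]
        simp
      rw [this]
      simp only [CharP.cast_eq_zero, mul_zero]
      positivity
    | succ y ihQ =>
      rw [← add_assoc]
      set j := j₀ + r with hj
      by_cases hQ : δ * n ≤ #Q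
      · obtain ⟨v, hv, hdeg⟩ := h Q (card_pos.1 (by omega)) hQ
        have hcE : #(Q.erase v) = y := by rw [card_erase_of_mem hv, hc]; rfl
        have h1 := ihQ _ hcE
        rw [← add_assoc, ← hj] at h1
        have h2 := ih {u ∈ Q | G.Adj v u}
        set m := #{u ∈ Q | G.Adj v u} with hm
        have h3 : (m : ℝ) ≤ α * y := by
          refine hdeg.trans (le_of_eq ?_)
          rw [hc]; push_cast; ring
        have h3' : (m : ℝ) ≤ y := h3.trans (mul_le_of_le_one_left (by positivity) hα1)
        have h4 : (cliqueCount G (j + 1) Q : ℝ) ≤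
            cliqueCount G (j + 1) (Q.erase v) + cliqueCount G j {u ∈ Q | G.Adj v u} := by
          exact_mod_cast cliqueCount_succ_le G j Q v
        -- A neighbourhood smaller by the factor `α` gains `α ^ j`, of which only `α ^ j₀` is kept,
        -- since `j ≥ j₀`. After `r` steps this gives `α ^ (j₀ * r)`.
        have h5 : α ^ (j₀ * r) * (m : ℝ) ^ j ≤ α ^ (j₀ * (r + 1)) * (y : ℝ) ^ j := by
          calc α ^ (j₀ * r) * (m : ℝ) ^ j ≤ α ^ (j₀ * r) * (α * y) ^ j := by gcongr
            _ = α ^ (j₀ * r + j) * (y : ℝ) ^ j := by rw [mul_pow, pow_add]; ring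
            _ ≤ α ^ (j₀ * (r + 1)) * (y : ℝ) ^ j := by
              refine mul_le_mul_of_nonneg_right (pow_le_pow_of_le_one hα hα1 ?_) (by positivity)
              rw [hj, mul_add]; omega
        have h6 : δ ^ j₀ * ((m : ℝ) + n) ^ j ≤ δ ^ j₀ * (y + n) ^ j := by gcongr
        have h7 : (j ! : ℝ) * cliqueCount G j {u ∈ Q | G.Adj v u} ≤
            α ^ (j₀ * (r + 1)) * (y : ℝ) ^ j + δ ^ j₀ * (y + n) ^ j := by linarith
        have h8 := mul_le_mul_of_nonneg_left (pow_succ_add_mul_pow_le (z := (y : ℝ)) (by positivity) j)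
          (show 0 ≤ α ^ (j₀ * (r + 1)) by positivity)
        have h9 := mul_le_mul_of_nonneg_left (pow_succ_add_mul_pow_le (z := (y : ℝ) + n)
          (by positivity) j) (show 0 ≤ δ ^ j₀ by positivity)
        have h10 : (((j + 1)! : ℕ) : ℝ) = (j + 1) * j ! := by rw [Nat.factorial_succ]; push_cast; rfl
        have h11 : (((j + 1)! : ℕ) : ℝ) * cliqueCount G (j + 1) Q ≤
            ((j + 1)! : ℕ) * cliqueCount G (j + 1) (Q.erase v) +
              (j + 1) * (j ! * cliqueCount G j {u ∈ Q | G.Adj v u}) := by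
          calc (((j + 1)! : ℕ) : ℝ) * cliqueCount G (j + 1) Q ≤ ((j + 1)! : ℕ) *
              (cliqueCount G (j + 1) (Q.erase v) + cliqueCount G j {u ∈ Q | G.Adj v u}) := by gcongr
            _ = _ := by rw [mul_add, h10]; ring
        have h12 := mul_le_mul_of_nonneg_left h7 (show (0 : ℝ) ≤ j + 1 by positivity)
        have h13 : (y : ℝ) + n + 1 = y + 1 + n := by ring
        rw [h13] at h9
        push_cast
        linarith
      · push Not at hQ
        have h1 : (((j + 1)! * cliqueCount G (j + 1) Q : ℕ) : ℝ) ≤ ((#Q ^ (j + 1) : ℕ) : ℝ) := by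
          exact_mod_cast factorial_mul_cliqueCount_le G (j + 1) Q
        push_cast at h1
        -- Small sets are absorbed by the error term. The shift by `n` makes that term dominate `n ^
        -- (j + 1)` while it still grows with `#Q` as the recursion needs.
        have h2 : (#Q : ℝ) ^ (j + 1) ≤ δ ^ j₀ * (#Q + n) ^ (j + 1) := by
          calc (#Q : ℝ) ^ (j + 1) ≤ (δ * n) ^ (j + 1) := by gcongr
            _ = δ ^ (j + 1) * n ^ (j + 1) := mul_pow _ _ _
            _ ≤ δ ^ j₀ * (#Q + n) ^ (j + 1) := by
              gcongr ?_ * ?_ ^ _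
              · exact pow_le_pow_of_le_one hδ hδ1 (by omega)
              · exact le_add_of_nonneg_left (by positivity)
        rw [hc] at h2 h1
        refine (h1.trans h2).trans (le_add_of_nonneg_left ?_)
        positivity

end CliqueCount

/-! ### Clique counting along a linear extension cut into blocks -/

section Blocks

open Finset
open scoped Classical Nat

variable {V : Type*} [PartialOrder V]

/-- Clique counting in an incomparability graph along a linear extension `f` that is cut into blocks
by `h`, when every vertex set has few elements with a small up-set inside their own block. -/
theorem factorial_mul_cliqueCount_incomparabilityGraph_le {f h : V → ℕ} {t w β : ℕ}
    (hf : Function.Injective f) (hfm : ∀ x y, x ≤ y → f x ≤ f y)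
    (hh : ∀ x y, f x ≤ f y → h x ≤ h y)
    (hw : ∀ (R : Finset V) (b : ℕ), #{u ∈ R | h u = b} ≤ w)
    (hbad : ∀ R : Finset V, ∃ B : Finset V, #B ≤ β ∧
      ∀ x ∈ R, x ∉ B → t ≤ #{u ∈ R | x ≤ u ∧ h u = h x})
    (i : ℕ) (B R : Finset V)
    (hB : ∀ x ∈ R, x ∉ B → t ≤ #{u ∈ R | x ≤ u ∧ h u = h x})
    (hfree : ¬ HasIncomparableFamily (i + 1) t R) :
    (i + 1)! * cliqueCount (incomparabilityGraph V) (i + 1) R ≤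
      ((i + 1) * i * (β + w) + (i + 1) * #(B ∩ R)) * #R ^ i := by
  induction i generalizing B R with
  | zero =>
    have hRB : R ⊆ B := by
      intro x hx
      by_contra hxB
      refine hfree ((hasIncomparableFamily_zero t ∅).cons (empty_subset _)
        (filter_subset _ _) (hB x hx hxB) ?_)
      simp
    have := factorial_mul_cliqueCount_le (incomparabilityGraph V) 1 R
    rw [inter_eq_right.2 hRB]
    simpa using this
  | succ i ih =>
    induction R using Finset.induction_on_min_value f with
    | empty =>
      have : cliqueCount (incomparabilityGraph V) (i + 1 + 1) ∅ = 0 := by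
        rw [cliqueCount, powersetCard_eq_empty.2 (by simp)]
        simp
      simp [this]
    | insert v s hv hmin ihs =>
      set G := incomparabilityGraph V with hG
      have hlt : ∀ x ∈ s, ¬ x ≤ v := by
        intro x hx hxv
        have := hf (le_antisymm (hmin x hx) (hfm _ _ hxv))
        exact hv (this ▸ hx)
      -- Removing the `f`-minimal `v` changes no up-set of another element, so the same `B` still
      -- serves.
      have hs := ihs (fun x hx hxB => by
        refine (hB x (mem_insert_of_mem hx) hxB).trans (card_le_card fun u hu => ?_)
        simp only [mem_filter, mem_insert] at hu ⊢
        refine ⟨hu.1.resolve_left fun huv => hlt x hx (huv ▸ hu.2.1), hu.2⟩)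
        (fun hfam => hfree (hfam.mono (subset_insert _ _)))
      set T : Finset V := {u ∈ insert v s | G.Adj v u} with hT
      have hTs : T ⊆ s := by
        intro u hu
        obtain ⟨hu1, hu2⟩ := mem_filter.1 hu
        exact (mem_insert.1 hu1).resolve_left fun huv => G.loopless.irrefl v (huv ▸ hu2)
      have hTc : #T ≤ #s := card_le_card hTs
      have hrec := cliqueCount_succ_le G (i + 1) (insert v s) v
      rw [erase_insert hv] at hrec
      have hrec' : (i + 1 + 1)! * cliqueCount G (i + 1 + 1) (insert v s) ≤
          (i + 1 + 1)! * cliqueCount G (i + 1 + 1) s +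
            (i + 1 + 1) * ((i + 1)! * cliqueCount G (i + 1) T) := by
        calc _ ≤ (i + 1 + 1)! * (cliqueCount G (i + 1 + 1) s + cliqueCount G (i + 1) T) :=
              Nat.mul_le_mul_left _ hrec
          _ = _ := by rw [Nat.factorial_succ (i + 1)]; ring
      have hpow := pow_succ_add_mul_pow_le (z := #s) (Nat.zero_le _) i
      simp only [Nat.cast_id] at hpow
      rw [card_insert_of_notMem hv]
      by_cases hvB : v ∈ B
      · have hBc : #(B ∩ insert v s) = #(B ∩ s) + 1 := by
          rw [inter_insert_of_mem hvB, card_insert_of_notMem fun h => hv (mem_inter.1 h).2]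
        have h1 : (i + 1)! * cliqueCount G (i + 1) T ≤ #s ^ (i + 1) :=
          (factorial_mul_cliqueCount_le G _ _).trans (Nat.pow_le_pow_left hTc _)
        rw [hBc]
        calc _ ≤ _ := hrec'
          _ ≤ ((i + 1 + 1) * (i + 1) * (β + w) + (i + 1 + 1) * #(B ∩ s)) * #s ^ (i + 1) +
              (i + 1 + 1) * #s ^ (i + 1) := by gcongr
          _ = ((i + 1 + 1) * (i + 1) * (β + w) + (i + 1 + 1) * (#(B ∩ s) + 1)) * #s ^ (i + 1) := by
              ring
          _ ≤ _ := by gcongr; omega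
      · have hBc : B ∩ insert v s = B ∩ s := inter_insert_of_notMem hvB
        set W : Finset V := {u ∈ T | h u = h v} with hW
        -- The up-set of `v` in its block would be the extra part. An element of `T \ W` above some
        -- part of it would be above `v`; one below would, lying after `v`, be in the block of `v`.
        have hfree' : ¬ HasIncomparableFamily (i + 1) t (T \ W) := by
          intro hfam
          refine hfree (hfam.cons ((sdiff_subset.trans hTs).trans (subset_insert _ _))
            (filter_subset (fun u => v ≤ u ∧ h u = h v) (insert v s))
            (hB v (mem_insert_self _ _) hvB) ?_)
          intro a ha b hb
          obtain ⟨-, hva, hha⟩ := mem_filter.1 ha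
          obtain ⟨hbT, hbW⟩ := mem_sdiff.1 hb
          have hadj : G.Adj v b := (mem_filter.1 hbT).2
          have hbh : h b ≠ h v := fun h => hbW (mem_filter.2 ⟨hbT, h⟩)
          refine ⟨fun hab => hadj.1 (hva.trans hab), fun hba => hbh ?_⟩
          exact le_antisymm (hha ▸ hh _ _ (hfm _ _ hba)) (hh _ _ (hmin b (hTs hbT)))
        obtain ⟨B', hB'c, hB'⟩ := hbad (T \ W)
        have h1 := ih B' (T \ W) hB' hfree'
        have h2 := factorial_mul_cliqueCount_succ_le_sdiff G i T W
        have h3 : #(T \ W) ≤ #s := (card_le_card sdiff_subset).trans hTc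
        have h4 : #(B' ∩ (T \ W)) ≤ β := (card_le_card inter_subset_left).trans hB'c
        have h5 : #W ≤ w := hw T (h v)
        have h6 : (i + 1)! * cliqueCount G (i + 1) T ≤ (i + 1) * (i + 1) * (β + w) * #s ^ i := by
          calc _ ≤ _ := h2
            _ ≤ ((i + 1) * i * (β + w) + (i + 1) * #(B' ∩ (T \ W))) * #(T \ W) ^ i +
                (i + 1) * (#W * #T ^ i) := by gcongr
            _ ≤ ((i + 1) * i * (β + w) + (i + 1) * β) * #s ^ i + (i + 1) * (w * #s ^ i) := by
                gcongr
            _ = _ := by ring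
        rw [hBc]
        calc _ ≤ _ := hrec'
          _ ≤ ((i + 1 + 1) * (i + 1) * (β + w) + (i + 1 + 1) * #(B ∩ s)) * #s ^ (i + 1) +
              (i + 1 + 1) * ((i + 1) * (i + 1) * (β + w) * #s ^ i) := by gcongr
          _ = (i + 1 + 1) * (i + 1) * (β + w) * (#s ^ (i + 1) + (i + 1) * #s ^ i) +
              (i + 1 + 1) * #(B ∩ s) * #s ^ (i + 1) := by ring
          _ ≤ (i + 1 + 1) * (i + 1) * (β + w) * (#s + 1) ^ (i + 1) +
              (i + 1 + 1) * #(B ∩ s) * (#s + 1) ^ (i + 1) := by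
                gcongr
                omega
          _ = _ := by ring

/-- The bad elements of one block have small up-sets among themselves, so the halving bound applies
to each of the at most `n / w + 1` blocks. -/
theorem exists_bad_set {f : V → ℕ} {n k t w L β : ℕ} (hfn : ∀ x, f x < n)
    (ht : t ≤ 2 ^ L) {R₀ : Finset V} (hfree : ¬ HasIncomparableFamily k t R₀)
    (hβ : (n / w + 1) * (2 * k * t * L + 2 * k * 2 ^ L + k * t) ≤ β)
    {R : Finset V} (hR : R ⊆ R₀) :
    ∃ B : Finset V, #B ≤ β ∧
      ∀ x ∈ R, x ∉ B → t ≤ #{u ∈ R | x ≤ u ∧ f u / w = f x / w} := by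
  set D : ℕ → Finset V := fun b =>
    {x ∈ R | f x / w = b ∧ #{u ∈ R | x ≤ u ∧ f u / w = f x / w} < t} with hD
  refine ⟨(range (n / w + 1)).biUnion D, ?_, ?_⟩
  · refine (card_biUnion_le_card_mul _ _ (2 * k * t * L + 2 * k * 2 ^ L + k * t) ?_).trans ?_
    · intro b _
      refine card_le_of_upIn_card_le L
        (fun h => hfree (h.mono ((filter_subset _ _).trans hR))) fun x hx => ?_
      obtain ⟨hxR, hxb, hxt⟩ := mem_filter.1 hx
      refine le_trans (card_le_card ?_) (hxt.le.trans ht)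
      intro u hu
      obtain ⟨hu, hxu⟩ := mem_upIn.1 hu
      obtain ⟨huR, hub, -⟩ := mem_filter.1 hu
      exact mem_filter.2 ⟨huR, hxu, hub.trans hxb.symm⟩
    · simpa using hβ
  · intro x hx hxB
    by_contra! hlt
    refine hxB (mem_biUnion.2 ⟨f x / w, ?_, mem_filter.2 ⟨hx, rfl, hlt⟩⟩)
    rw [mem_range]
    have := Nat.div_le_div_right (c := w) (hfn x).le
    omega

theorem exists_linearExtension_nat (V : Type*) [PartialOrder V] [Fintype V] :
    ∃ f : V → ℕ, Function.Injective f ∧ (∀ x y, x ≤ y → f x ≤ f y) ∧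
      ∀ x, f x < Fintype.card V := by
  let _ : Fintype (LinearExtension V) := inferInstanceAs (Fintype V)
  let e := Fintype.orderIsoFinOfCardEq (LinearExtension V) rfl
  refine ⟨fun x => (e.symm (toLinearExtension x) : ℕ), ?_, ?_, fun x => ?_⟩
  · intro x y hxy
    exact e.symm.injective (Fin.ext hxy)
  · intro x y hxy
    exact Fin.le_def.1 (e.symm.monotone (toLinearExtension.monotone hxy))
  · exact (e.symm (toLinearExtension x)).2

theorem card_filter_div_eq_le {V : Type*} {f : V → ℕ} {w : ℕ} (hw : 0 < w) (hf : Function.Injective f)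
    (R : Finset V) (b : ℕ) : #{u ∈ R | f u / w = b} ≤ w := by
  calc #{u ∈ R | f u / w = b} = #(image f {u ∈ R | f u / w = b}) :=
        (card_image_of_injective _ hf).symm
    _ ≤ #(Ico (b * w) (b * w + w)) := by
        refine card_le_card fun m hm => ?_
        obtain ⟨u, hu, rfl⟩ := mem_image.1 hm
        obtain ⟨-, rfl⟩ := mem_filter.1 hu
        exact mem_Ico.2 ⟨Nat.div_mul_le_self _ _, Nat.lt_div_mul_add hw⟩
    _ = w := by simp

theorem factorial_mul_cliqueCount_univ_le [Fintype V] {k t w L : ℕ} (hk : 0 < k) (hw : 0 < w)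
    (ht : t ≤ 2 ^ L) (hfree : ¬ HasIncomparableFamily k t (univ : Finset V)) :
    k ! * cliqueCount (incomparabilityGraph V) k univ ≤
      k ^ 2 * ((Fintype.card V / w + 1) * (2 * k * t * L + 2 * k * 2 ^ L + k * t) + w) *
        Fintype.card V ^ (k - 1) := by
  obtain ⟨f, hf, hfm, hfn⟩ := exists_linearExtension_nat V
  obtain ⟨i, rfl⟩ : ∃ i, k = i + 1 := ⟨k - 1, by omega⟩
  have hbad := fun R : Finset V => exists_bad_set (w := w) hfn ht hfree le_rfl (subset_univ R)
  set β := (Fintype.card V / w + 1) *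
    (2 * (i + 1) * t * L + 2 * (i + 1) * 2 ^ L + (i + 1) * t) with hβ
  obtain ⟨B, hBc, hB⟩ := hbad univ
  have h := factorial_mul_cliqueCount_incomparabilityGraph_le hf hfm
    (fun x y hxy => Nat.div_le_div_right hxy) (card_filter_div_eq_le hw hf) hbad i B univ hB hfree
  refine h.trans ?_
  rw [card_univ, Nat.add_sub_cancel]
  refine Nat.mul_le_mul_right _ ?_
  have hB' : #(B ∩ univ) ≤ β := by simpa using hBc
  calc (i + 1) * i * (β + w) + (i + 1) * #(B ∩ univ)
      ≤ (i + 1) * i * (β + w) + (i + 1) * (β + w) := by gcongr; omega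
    _ = (i + 1) ^ 2 * (β + w) := by ring

end Blocks

/-! ### Choice of parameters and the two ranges of `k` -/

section Numerics

open Finset
open scoped Classical Nat

theorem two_pow_clog_le {m : ℕ} (hm : 1 ≤ m) : 2 ^ Nat.clog 2 m ≤ 2 * m := by
  rcases hm.eq_or_lt with rfl | hm
  · simp
  · have h := Nat.pow_pred_clog_lt_self (b := 2) one_lt_two hm
    have hpos := Nat.clog_pos one_lt_two hm
    calc 2 ^ Nat.clog 2 m = 2 ^ (Nat.clog 2 m).pred * 2 := by
          rw [← pow_succ, Nat.pred_eq_sub_one, Nat.sub_add_cancel hpos]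
      _ ≤ 2 * m := by omega

theorem clog_le_log {m n : ℕ} (hm : 1 ≤ m) (hmn : m ≤ n) :
    -- The constant `1.45` exceeds `1 / log 2`.
    (Nat.clog 2 m : ℝ) ≤ 1 + 1.45 * Real.log n := by
  have h1 : ((2 ^ Nat.clog 2 m : ℕ) : ℝ) ≤ ((2 * n : ℕ) : ℝ) := by
    exact_mod_cast (two_pow_clog_le hm).trans (by omega)
  have hn : (0 : ℝ) < n := by exact_mod_cast (by omega : 0 < n)
  push_cast at h1
  have h2 := Real.log_le_log (by positivity) h1
  rw [Real.log_pow, Real.log_mul two_ne_zero hn.ne'] at h2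
  have h3 := Real.log_two_gt_d9
  have h4 : 0 ≤ Real.log n := Real.log_nonneg (by exact_mod_cast (by omega : 1 ≤ n))
  by_contra! h5
  nlinarith

theorem upIn_bound_le {n k t : ℕ} (ht : 1 ≤ t) (htn : t ≤ n) (hn : 7 ≤ Real.log n) :
    ((2 * k * t * Nat.clog 2 t + 2 * k * 2 ^ Nat.clog 2 t + k * t : ℕ) : ℝ) ≤
      4 * k * t * Real.log n := by
  have h1 := clog_le_log ht htn
  have h2 : ((2 ^ Nat.clog 2 t : ℕ) : ℝ) ≤ ((2 * t : ℕ) : ℝ) := by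
    exact_mod_cast two_pow_clog_le ht
  push_cast at h2 ⊢
  calc 2 * k * t * (Nat.clog 2 t : ℝ) + 2 * k * 2 ^ Nat.clog 2 t + k * t
      ≤ 2 * k * t * (1 + 1.45 * Real.log n) + 2 * k * (2 * t) + k * t := by gcongr
    _ = k * t * (7 + 2.9 * Real.log n) := by ring
    _ ≤ k * t * (4 * Real.log n) := by gcongr; linarith
    _ = _ := by ring

theorem half_pow_le_factorial_mul_choose {n k : ℕ} (hn : 0 < n) (hkn : 2 * k ^ 2 ≤ n) :
    (n : ℝ) ^ k / 2 ≤ k ! * n.choose k := by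
  have h1 : (((n + 1 - k) ^ k : ℕ) : ℝ) ≤ ((k ! * n.choose k : ℕ) : ℝ) := by
    rw [← Nat.descFactorial_eq_factorial_mul_choose]
    exact_mod_cast Nat.pow_sub_le_descFactorial n k
  have hkn' : k ≤ n := by nlinarith
  have hn' : (0 : ℝ) < n := by exact_mod_cast hn
  have h2 : (2 * k ^ 2 : ℝ) ≤ n := by exact_mod_cast hkn
  have hk1 : (k : ℝ) / n ≤ 1 := by
    rw [div_le_one hn']; exact_mod_cast hkn'
  push_cast [Nat.cast_sub (show k ≤ n + 1 by omega)] at h1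
  have h3 := one_add_mul_le_pow (a := -((k : ℝ) / n)) (by linarith) k
  have h4 : (1 : ℝ) / 2 ≤ 1 + k * -((k : ℝ) / n) := by
    have : (k : ℝ) * (k / n) ≤ 1 / 2 := by
      rw [← mul_div_assoc, div_le_div_iff₀ hn' two_pos]
      linarith
    linarith
  calc (n : ℝ) ^ k / 2 = n ^ k * (1 / 2) := by ring
    _ ≤ n ^ k * (1 + -((k : ℝ) / n)) ^ k := by gcongr; exact h4.trans h3
    _ = (n - k) ^ k := by rw [← mul_pow]; congr 1; field_simp; ring
    _ ≤ (n + 1 - k) ^ k := by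
        gcongr
        · rw [sub_nonneg]; exact_mod_cast hkn'
        · linarith
    _ ≤ _ := h1

theorem cube_le_four_pow {k : ℕ} (hk : 2 ≤ k) : k ^ 3 ≤ 4 ^ k := by
  induction k, hk using Nat.le_induction with
  | base => norm_num
  | succ k hk ih =>
    have h : (2 * (k + 1)) ^ 3 ≤ (3 * k) ^ 3 := Nat.pow_le_pow_left (by omega) 3
    rw [mul_pow, mul_pow] at h
    calc (k + 1) ^ 3 ≤ 4 * k ^ 3 := by omega
      _ ≤ 4 * 4 ^ k := by gcongr
      _ = 4 ^ (k + 1) := by ring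

variable {V : Type*} [PartialOrder V] [Fintype V]

theorem half_mul_pow_le_factorial_mul_cliqueCount {V : Type*} [Fintype V] {c : ℝ} {k : ℕ} {G : SimpleGraph V}
    (hc : 0 ≤ c) (hV : 0 < Fintype.card V) (hkV : 2 * k ^ 2 ≤ Fintype.card V)
    (h : c ≤ cliqueDensity k G) :
    c * ((Fintype.card V : ℝ) ^ k / 2) ≤ k ! * cliqueCount G k univ := by
  have h1 : (G.cliqueSet k).ncard = cliqueCount G k univ := by
    rw [cliqueCount, ← Set.ncard_coe_finset]
    congr 1
    ext S
    simp [SimpleGraph.mem_cliqueSet_iff, SimpleGraph.isNClique_iff, and_comm]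
  have h2 := half_pow_le_factorial_mul_choose hV hkV
  have h3 : (0 : ℝ) < (Fintype.card V).choose k := by
    exact_mod_cast Nat.choose_pos (by nlinarith)
  rw [cliqueDensity, h1, Nat.card_eq_fintype_card, le_div_iff₀ h3] at h
  calc c * ((Fintype.card V : ℝ) ^ k / 2) ≤ c * (k ! * (Fintype.card V).choose k) := by gcongr
    _ = k ! * (c * (Fintype.card V).choose k) := by ring
    _ ≤ _ := by gcongr

/-- The case in which `k` is small in terms of `c`. -/
theorem hasIncomparableFamily_of_sq_mul_cube_le {c : ℝ} {k t n : ℕ} (hc : 0 < c)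
    (hc1 : c < 1 / 2) (hk : 2 ≤ k) (hck : c ^ 2 * k ^ 3 ≤ 10 ^ 5) (hV : Fintype.card V = n)
    (hlog : 7 ≤ Real.log n) (ht : 1 ≤ t) (htn : t ≤ n) (hn : 2 * k ^ 2 ≤ n)
    (hcn : 10 ≤ c * n / (4 * k ^ 2))
    (ht2 : (t : ℝ) * (k ^ 2 * Real.log n) ≤ 2 * c ^ 4 * n / 10 ^ 8)
    (hdens : c ≤ cliqueDensity k (incomparabilityGraph V)) :
    HasIncomparableFamily k t (univ : Finset V) := by
  by_contra hfree
  have hkR : (2 : ℝ) ≤ k := by exact_mod_cast hk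
  have hn0 : 0 < n := by omega
  have hnR : (0 : ℝ) < n := by exact_mod_cast hn0
  -- With this block length `k ^ 2 * w` uses at most half of the lower bound `c * n / 2`, while
  -- there are only about `4 * k ^ 2 / c` blocks.
  set w := ⌊c * n / (4 * k ^ 2)⌋₊ with hwdef
  have hw1 : (w : ℝ) ≤ c * n / (4 * k ^ 2) := Nat.floor_le (by positivity)
  have hw2 : c * n / (4 * k ^ 2) < w + 1 := Nat.lt_floor_add_one _
  have hwR : (0 : ℝ) < w := by linarith
  have hw0 : 0 < w := by exact_mod_cast hwR
  have h1 := factorial_mul_cliqueCount_univ_le (k := k) (by omega) hw0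
    (Nat.le_pow_clog one_lt_two t) hfree
  have h2 := half_mul_pow_le_factorial_mul_cliqueCount hc.le (hV ▸ hn0) (hV ▸ hn) hdens
  have hB := upIn_bound_le (k := k) ht htn hlog
  rw [hV] at h1 h2
  set D := 2 * k * t * Nat.clog 2 t + 2 * k * 2 ^ Nat.clog 2 t + k * t with hD
  have h3 : c * ((n : ℝ) ^ k / 2) ≤ k ^ 2 * (((n / w : ℕ) + 1) * D + w) * n ^ (k - 1) := by
    refine h2.trans ?_
    exact_mod_cast h1
  have h4 : c * n / 2 ≤ k ^ 2 * (((n / w : ℕ) + 1) * D + w) := by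
    have hpow : (n : ℝ) ^ k = n * n ^ (k - 1) := by
      rw [← pow_succ']; congr 1; omega
    rw [hpow] at h3
    refine le_of_mul_le_mul_right (a := (n : ℝ) ^ (k - 1)) ?_ (by positivity)
    calc _ = c * (n * (n : ℝ) ^ (k - 1) / 2) := by ring
      _ ≤ _ := h3
  have h5 : (((n / w : ℕ) : ℝ) + 1) ≤ 5 * k ^ 2 / c := by
    have h51 : ((n / w : ℕ) : ℝ) ≤ n / w := Nat.cast_div_le
    have h52 : (n : ℝ) / w ≤ 4.5 * k ^ 2 / c := by
      rw [div_le_div_iff₀ hwR hc]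
      have : 0.9 * (c * n / (4 * k ^ 2)) ≤ w := by linarith
      calc (n : ℝ) * c = 4 / 0.9 * k ^ 2 * (0.9 * (c * n / (4 * k ^ 2))) := by field_simp
        _ ≤ 4 / 0.9 * k ^ 2 * w := by gcongr
        _ ≤ 4.5 * k ^ 2 * w := by gcongr; norm_num
    have h53 : (1 : ℝ) ≤ 0.5 * k ^ 2 / c := by
      rw [le_div_iff₀ hc]; nlinarith
    calc ((n / w : ℕ) : ℝ) + 1 ≤ 4.5 * k ^ 2 / c + 0.5 * k ^ 2 / c := by linarith
      _ = _ := by ring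
  have h6 : (k : ℝ) ^ 2 * (((n / w : ℕ) + 1) * D) ≤ 0.04 * c * n := by
    calc (k : ℝ) ^ 2 * (((n / w : ℕ) + 1) * D)
        ≤ k ^ 2 * (5 * k ^ 2 / c * (4 * k * t * Real.log n)) := by gcongr
      _ = 20 * k ^ 3 / c * (t * (k ^ 2 * Real.log n)) := by ring
      _ ≤ 20 * k ^ 3 / c * (2 * c ^ 4 * n / 10 ^ 8) := by gcongr
      -- Here the bad elements are negligible exactly because `c ^ 2 * k ^ 3` is bounded.
      _ = 40 / 10 ^ 8 * c * n * (c ^ 2 * k ^ 3) := by field_simp; ring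
      _ ≤ 40 / 10 ^ 8 * c * n * 10 ^ 5 := by gcongr
      _ = 0.04 * c * n := by ring
  have h7 : (k : ℝ) ^ 2 * w ≤ c * n / 4 := by
    calc (k : ℝ) ^ 2 * w ≤ k ^ 2 * (c * n / (4 * k ^ 2)) := by gcongr
      _ = c * n / 4 := by field_simp
  have h8 : 0 < c * n := by positivity
  linarith

/-- The first term is about `exp (-k / 16)` and the second at most `4 / 2 ^ k`, whereas `c` exceeds
a constant times `k ^ (-3 / 2)`. Squares are compared, to avoid fractional powers. -/
theorem pow_add_pow_lt {c : ℝ} {k : ℕ} (hc : 0 < c) (hc1 : c < 1 / 2)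
    (hck : 10 ^ 5 < c ^ 2 * k ^ 3) :
    (1 - 1 / (4 * k) : ℝ) ^ (k / 2 * (k - k / 2)) + (1 / 16) ^ (k / 2) * 2 ^ k < c / 2 := by
  have hk3 : (4 * 10 ^ 5 : ℝ) < k ^ 3 := by
    have : c ^ 2 < 1 / 4 := by nlinarith
    have hk0 : (0 : ℝ) ≤ k ^ 3 := by positivity
    nlinarith
  have hk : 70 ≤ k := by
    by_contra! hlt
    have h1 : (k : ℝ) ≤ 70 := by exact_mod_cast hlt.le
    have h2 : (k : ℝ) ^ 3 ≤ 70 ^ 3 := by gcongr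
    norm_num at h2 hk3
    linarith
  have hkR : (70 : ℝ) ≤ k := by exact_mod_cast hk
  have hkp : (0 : ℝ) < k := by linarith
  have hc4 : 6250 / (k : ℝ) ^ 3 < (c / 4) ^ 2 := by
    rw [div_lt_iff₀ (by positivity)]
    linarith
  have key : ∀ z : ℝ, z ^ 2 ≤ 6250 / (k : ℝ) ^ 3 → z < c / 4 := fun z hz =>
    lt_of_pow_lt_pow_left₀ 2 (by positivity) (hz.trans_lt hc4)
  have hα : (0 : ℝ) ≤ 1 - 1 / (4 * k) := by
    rw [sub_nonneg, div_le_one (by positivity)]; linarith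
  have h1 : (1 - 1 / (4 * k) : ℝ) ^ (k / 2 * (k - k / 2)) < c / 4 := by
    apply key
    have hprod : (k : ℝ) ^ 2 - 1 ≤ 4 * ((k / 2 * (k - k / 2) : ℕ) : ℝ) := by
      have : k ^ 2 ≤ 4 * (k / 2 * (k - k / 2)) + 1 := by
        rcases Nat.even_or_odd' k with ⟨m, rfl | rfl⟩
        · rw [show 2 * m / 2 = m by omega, show 2 * m - m = m by omega]; nlinarith
        · rw [show (2 * m + 1) / 2 = m by omega, show 2 * m + 1 - m = m + 1 by omega]; nlinarith
      have h : ((k ^ 2 : ℕ) : ℝ) ≤ ((4 * (k / 2 * (k - k / 2)) + 1 : ℕ) : ℝ) := by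
        exact_mod_cast this
      push_cast at h ⊢
      linarith
    set m := k / 2 * (k - k / 2) with hm
    have hexp : ((1 - 1 / (4 * k) : ℝ) ^ m) ^ 2 ≤ Real.exp (-(k / 9)) := by
      calc ((1 - 1 / (4 * k) : ℝ) ^ m) ^ 2 ≤ (Real.exp (-(1 / (4 * k))) ^ m) ^ 2 := by
            gcongr; exact Real.one_sub_le_exp_neg _
        _ = Real.exp ((2 * m : ℕ) * -(1 / (4 * k))) := by
            rw [Real.exp_nat_mul, ← pow_mul, mul_comm m 2]
        _ ≤ Real.exp (-(k / 9)) := by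
            apply Real.exp_le_exp.2
            push_cast
            have : (k : ℝ) / 9 ≤ 2 * m * (1 / (4 * k)) := by
              rw [mul_one_div, div_le_div_iff₀ (by norm_num) (by positivity)]
              nlinarith
            linarith
    refine hexp.trans ?_
    rw [Real.exp_neg, inv_le_comm₀ (Real.exp_pos _) (by positivity), inv_div]
    have := Real.pow_div_factorial_le_exp ((k : ℝ) / 9) (by positivity) 3
    refine le_trans ?_ this
    rw [show (3 ! : ℕ) = 6 from rfl]
    have hk30 : (0 : ℝ) ≤ k ^ 3 := by positivity
    push_cast
    rw [div_pow]
    linarith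
  have h2 : (1 / 16 : ℝ) ^ (k / 2) * 2 ^ k < c / 4 := by
    apply key
    have h21 : (4 : ℝ) ^ k ≤ 4 * 16 ^ (k / 2) := by
      calc (4 : ℝ) ^ k ≤ 4 ^ (2 * (k / 2) + 1) := by
            apply pow_le_pow_right₀ (by norm_num); omega
        _ = 4 * 16 ^ (k / 2) := by rw [pow_succ, pow_mul]; norm_num; ring
    have h22 : (1 / 16 : ℝ) ^ (k / 2) * 2 ^ k ≤ 4 / 2 ^ k := by
      rw [one_div, inv_pow, inv_mul_le_iff₀ (by positivity), ← mul_div_assoc,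
        le_div_iff₀ (by positivity), ← mul_pow]
      norm_num
      linarith
    have h23 : (k : ℝ) ^ 3 ≤ 4 ^ k := by exact_mod_cast cube_le_four_pow (by omega : 2 ≤ k)
    calc ((1 / 16 : ℝ) ^ (k / 2) * 2 ^ k) ^ 2 ≤ (4 / 2 ^ k) ^ 2 := by gcongr
      _ = 16 / 4 ^ k := by rw [div_pow, ← pow_mul, mul_comm k 2, pow_mul]; norm_num
      _ ≤ 6250 / (k : ℝ) ^ 3 := by gcongr; norm_num
  linarith

/-- Otherwise the low-degree count applies with `δ = 1 / 16` and the clique size split into two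
halves, giving fewer than `c / 2 * n ^ k` ordered cliques. -/
theorem exists_dense_set {V : Type*} [Fintype V] {c : ℝ} {k n : ℕ} (hc : 0 < c) (hc1 : c < 1 / 2)
    (hck : 10 ^ 5 < c ^ 2 * k ^ 3) (hV : Fintype.card V = n) (hn0 : 0 < n) (hn : 2 * k ^ 2 ≤ n)
    {G : SimpleGraph V} (hdens : c ≤ cliqueDensity k G) :
    ∃ Q : Finset V, (n : ℝ) / 16 ≤ #Q ∧
      ∀ v ∈ Q, (1 - 1 / (4 * k) : ℝ) * (#Q - 1) < #{u ∈ Q | G.Adj v u} := by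
  by_contra! hno
  have hnR : (0 : ℝ) < n := by exact_mod_cast hn0
  have hk : 1 ≤ k := by
    by_contra! h
    obtain rfl : k = 0 := by omega
    norm_num at hck
  have hkR : (1 : ℝ) ≤ k := by exact_mod_cast hk
  have h1 := factorial_mul_cliqueCount_le_of_exists_low_degree G (n := n) (δ := 1 / 16)
    (α := 1 - 1 / (4 * k)) hnR.le (by norm_num) (by norm_num)
    (by rw [sub_nonneg, div_le_one (by positivity)]; linarith)
    (by rw [sub_le_self_iff]; positivity)
    (fun Q _ hQ => hno Q (by linarith)) (k / 2) (k - k / 2) univ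
  rw [show k / 2 + (k - k / 2) = k by omega, card_univ, hV] at h1
  have h2 := half_mul_pow_le_factorial_mul_cliqueCount hc.le (hV ▸ hn0) (hV ▸ hn) hdens
  rw [hV] at h2
  have h3 := mul_lt_mul_of_pos_right (pow_add_pow_lt hc hc1 hck)
    (show (0 : ℝ) < (n : ℝ) ^ k by positivity)
  rw [← two_mul, mul_pow] at h1
  linarith

/-- The case in which `k` is large in terms of `c`. -/
theorem hasIncomparableFamily_of_lt_sq_mul_cube {c : ℝ} {k t n : ℕ} (hc : 0 < c)
    (hc1 : c < 1 / 2) (hk : 2 ≤ k) (hck : 10 ^ 5 < c ^ 2 * k ^ 3) (hV : Fintype.card V = n)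
    (hlog : 7 ≤ Real.log n) (ht : 1 ≤ t) (htn : t ≤ n) (hn : 200 * k ^ 2 ≤ n)
    (ht2 : (t : ℝ) * (k ^ 2 * Real.log n) ≤ 2 * c ^ 4 * n / 10 ^ 8)
    (hdens : c ≤ cliqueDensity k (incomparabilityGraph V)) :
    HasIncomparableFamily k t (univ : Finset V) := by
  by_contra hfree
  have hkR : (2 : ℝ) ≤ k := by exact_mod_cast hk
  have hkp : (0 : ℝ) < k := by linarith
  have hn0 : 0 < n := by nlinarith
  have hnR : (0 : ℝ) < n := by exact_mod_cast hn0
  have hn200 : (200 * k ^ 2 : ℝ) ≤ n := by exact_mod_cast hn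
  have htR : (1 : ℝ) ≤ t := by exact_mod_cast ht
  obtain ⟨Q, hQn, hQ⟩ := exists_dense_set hc hc1 hck hV hn0 (by omega) hdens
  have hQ12 : 12 * k ≤ #Q := by
    have : ((12 * k : ℕ) : ℝ) ≤ #Q := by push_cast; nlinarith
    exact_mod_cast this
  have hc4 : c ^ 4 ≤ 1 / 16 := by
    calc c ^ 4 ≤ (1 / 2) ^ 4 := by gcongr
      _ = 1 / 16 := by norm_num
  have htk : (t : ℝ) * (k ^ 2 * Real.log n) ≤ n / 10 ^ 8 := by
    refine ht2.trans ?_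
    rw [div_le_div_iff_of_pos_right (by norm_num)]
    nlinarith
  set D := 2 * k * t * Nat.clog 2 t + 2 * k * 2 ^ Nat.clog 2 t + k * t with hD
  have hD1 : 1 ≤ D := by
    have : 1 ≤ k * t := Nat.mul_pos (by omega) ht
    omega
  have hDR : (D : ℝ) ≤ 4 * k * t * Real.log n := upIn_bound_le ht htn hlog
  have hDn : D ≤ n := by
    have : (D : ℝ) ≤ n := by
      calc (D : ℝ) ≤ 4 * k * t * Real.log n := hDR
        _ ≤ 4 * k * t * Real.log n * k := le_mul_of_one_le_right (by positivity) (by linarith)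
        _ = 4 * (t * (k ^ 2 * Real.log n)) := by ring
        _ ≤ n := by linarith
    exact_mod_cast this
  have htotal : ((2 * k * t * Nat.clog 2 D + 2 * k * 2 ^ Nat.clog 2 D + k * t : ℕ) : ℝ) ≤
      n / 10 ^ 6 := by
    have h1 := clog_le_log hD1 hDn
    have h2 : ((2 ^ Nat.clog 2 D : ℕ) : ℝ) ≤ ((2 * D : ℕ) : ℝ) := by
      exact_mod_cast two_pow_clog_le hD1
    push_cast at h2 ⊢
    calc 2 * k * t * (Nat.clog 2 D : ℝ) + 2 * k * 2 ^ Nat.clog 2 D + k * t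
        ≤ 2 * k * t * (1 + 1.45 * Real.log n) + 2 * k * (2 * (4 * k * t * Real.log n)) + k * t := by
          gcongr
          exact h2.trans (by gcongr)
      _ = k * t * (3 + 2.9 * Real.log n) + 16 * (t * (k ^ 2 * Real.log n)) := by ring
      _ ≤ k * t * (4 * Real.log n) * k + 16 * (t * (k ^ 2 * Real.log n)) := by
          refine add_le_add_left ?_ _
          calc k * t * (3 + 2.9 * Real.log n) ≤ k * t * (4 * Real.log n) := by gcongr; linarith
            _ ≤ k * t * (4 * Real.log n) * k :=
                le_mul_of_one_le_right (by positivity) (by linarith)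
      _ = 20 * (t * (k ^ 2 * Real.log n)) := by ring
      _ ≤ n / 10 ^ 6 := by linarith
  -- The `k` rounds delete at most `2 * k * d ≤ #Q / 2 + 2 * k` elements, and `12 * k ≤ #Q` leaves a
  -- third of `Q` throughout.
  refine hfree ((hasIncomparableFamily_of_intervals (m := #Q / 3) (d := #Q / (4 * k) + 1)
    (Q := Q) ?_ ?_ k subset_rfl ?_).mono (subset_univ _))
  · intro S _ hSc
    have hlarge : 2 * k * t * Nat.clog 2 D + 2 * k * 2 ^ Nat.clog 2 D + k * t < #S := by
      have h1 : #Q < 3 * (#S + 1) := by omega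
      have h2 : (#Q : ℝ) < 3 * (#S + 1) := by exact_mod_cast h1
      have h3 : ((2 * k * t * Nat.clog 2 D + 2 * k * 2 ^ Nat.clog 2 D + k * t : ℕ) : ℝ) < #S := by
        nlinarith
      exact_mod_cast h3
    obtain ⟨x, hx, y, hy, hxy⟩ := exists_large_interval (L₁ := Nat.clog 2 t) (L₂ := Nat.clog 2 D)
      (fun h => hfree (h.mono (subset_univ _))) (Nat.le_pow_clog one_lt_two D) hlarge
    exact ⟨x, hx, y, hy, (Nat.le_pow_clog one_lt_two t).trans hxy.le⟩
  · intro x hx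
    have h1 := hQ x hx
    set G := incomparabilityGraph V with hG
    have h2 : #{y ∈ Q | x ≤ y ∨ y ≤ x} + #{u ∈ Q | G.Adj x u} = #Q := by
      rw [← card_filter_add_card_filter_not (s := Q) (fun y => x ≤ y ∨ y ≤ x)]
      congr 2
      refine filter_congr fun u _ => ?_
      rw [not_or]
      rfl
    set e := #{y ∈ Q | x ≤ y ∨ y ≤ x} with he
    have h3 : (e : ℝ) + #{u ∈ Q | G.Adj x u} = #Q := by exact_mod_cast h2
    have h4 : ((e : ℝ) - 1) * (4 * k) ≤ #Q := by
      -- The `- 1` accounts for `x`, which is comparable to itself.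
      have h41 : (e : ℝ) - 1 < 1 / (4 * k) * (#Q - 1) := by
        have : (1 - 1 / (4 * k) : ℝ) * (#Q - 1) = #Q - 1 - 1 / (4 * k) * (#Q - 1) := by ring
        linarith
      have h42 : ((e : ℝ) - 1) * (4 * k) ≤ 1 / (4 * k) * (#Q - 1) * (4 * k) := by gcongr
      have h43 : 1 / (4 * k) * ((#Q : ℝ) - 1) * (4 * k) = #Q - 1 := by field_simp
      linarith
    have h5 : (e - 1) * (4 * k) ≤ #Q := by
      rcases Nat.eq_zero_or_pos e with h0 | h0
      · simp [h0]
      · have : (((e - 1) * (4 * k) : ℕ) : ℝ) ≤ #Q := by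
          push_cast [Nat.cast_sub h0]; exact h4
        exact_mod_cast this
    have := (Nat.le_div_iff_mul_le (by omega)).2 h5
    omega
  · have h1 : #Q / (4 * k) * (4 * k) ≤ #Q := Nat.div_mul_le_self _ _
    have h2 : k * (2 * (#Q / (4 * k) + 1)) * 2 = #Q / (4 * k) * (4 * k) + 4 * k := by ring
    omega

end Numerics

/-! ### The theorem for large `n` -/

theorem theorem1p7 (c : ℝ) (hc0 : 0 < c) (hc1 : c < 1 / 2) (k : ℕ) (hk : 2 ≤ k) :
    ∃ n₀ : ℕ, ∀ n : ℕ, n₀ ≤ n →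
      ∀ (V : Type*) [Fintype V] (G : SimpleGraph V), Fintype.card V = n →
        IsIncomparabilityGraph G → c ≤ cliqueDensity k G →
          (blowup (SimpleGraph.completeGraph (Fin k))
            ⌈c ^ 4 * (n : ℝ) / (10 ^ 8 * (k : ℝ) ^ 2 * Real.log (n : ℝ))⌉₊).IsContained G := by
  have hkR : (2 : ℝ) ≤ k := by exact_mod_cast hk
  have hkp : (0 : ℝ) < k := by linarith
  have hε : 0 < c ^ 4 / (10 ^ 8 * (k : ℝ) ^ 2) := by positivity
  have e1 : ∀ᶠ n : ℕ in Filter.atTop, Real.log n ≤ c ^ 4 / (10 ^ 8 * (k : ℝ) ^ 2) * n := by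
    filter_upwards [tendsto_natCast_atTop_atTop.eventually
      (Real.isLittleO_log_id_atTop.def hε)] with n hn
    simpa using (le_abs_self _).trans hn
  have e2 : ∀ᶠ n : ℕ in Filter.atTop, 7 ≤ Real.log n :=
    (Real.tendsto_log_atTop.comp tendsto_natCast_atTop_atTop).eventually_ge_atTop 7
  have e3 : ∀ᶠ n : ℕ in Filter.atTop, 40 * (k : ℝ) ^ 2 / c ≤ n :=
    tendsto_natCast_atTop_atTop.eventually_ge_atTop _
  have e4 : ∀ᶠ n : ℕ in Filter.atTop, 200 * k ^ 2 ≤ n := Filter.eventually_ge_atTop _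
  obtain ⟨n₀, hn₀⟩ := Filter.eventually_atTop.1 (e1.and (e2.and (e3.and e4)))
  refine ⟨n₀, fun n hn V _ G hV hG hdens => ?_⟩
  obtain ⟨h1, h2, h3, h4⟩ := hn₀ n hn
  obtain ⟨po, rfl⟩ := hG
  have hn0 : 0 < n := by nlinarith
  have hnR : (0 : ℝ) < n := by exact_mod_cast hn0
  have hlog : 0 < Real.log n := by linarith
  set x : ℝ := c ^ 4 * (n : ℝ) / (10 ^ 8 * (k : ℝ) ^ 2 * Real.log (n : ℝ)) with hx
  have hxk : x * (k ^ 2 * Real.log n) = c ^ 4 * n / 10 ^ 8 := by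
    rw [hx]; field_simp
  have hx1 : 1 ≤ x := by
    rw [hx, le_div_iff₀ (by positivity)]
    calc 1 * (10 ^ 8 * (k : ℝ) ^ 2 * Real.log n)
        ≤ 10 ^ 8 * (k : ℝ) ^ 2 * (c ^ 4 / (10 ^ 8 * (k : ℝ) ^ 2) * n) := by
          rw [one_mul]; gcongr
      _ = c ^ 4 * n := by field_simp
  have ht1 : 1 ≤ ⌈x⌉₊ := Nat.one_le_ceil_iff.2 (by linarith)
  -- As `log n = o(n)` gives `x ≥ 1`, rounding up costs at most a factor 2.
  have ht2x : (⌈x⌉₊ : ℝ) ≤ 2 * x := by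
    have := Nat.ceil_lt_add_one (show 0 ≤ x by linarith)
    linarith
  have ht2 : (⌈x⌉₊ : ℝ) * (k ^ 2 * Real.log n) ≤ 2 * c ^ 4 * n / 10 ^ 8 := by
    calc (⌈x⌉₊ : ℝ) * (k ^ 2 * Real.log n) ≤ 2 * x * (k ^ 2 * Real.log n) := by gcongr
      _ = 2 * (x * (k ^ 2 * Real.log n)) := by ring
      _ = _ := by rw [hxk]; ring
  have htn : ⌈x⌉₊ ≤ n := by
    apply Nat.ceil_le.2
    have hc4 : c ^ 4 ≤ 1 := pow_le_one₀ hc0.le (by linarith)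
    have hkl : (1 : ℝ) ≤ k ^ 2 * Real.log n := by nlinarith
    calc x ≤ x * (k ^ 2 * Real.log n) := le_mul_of_one_le_right (by linarith) hkl
      _ = c ^ 4 * n / 10 ^ 8 := hxk
      _ ≤ 1 * n / 1 := by gcongr; norm_num
      _ = n := by ring
  refine HasIncomparableFamily.isContained (R := Finset.univ) ?_
  rcases le_or_gt (c ^ 2 * (k : ℝ) ^ 3) (10 ^ 5) with hck | hck
  · refine hasIncomparableFamily_of_sq_mul_cube_le hc0 hc1 hk hck hV h2 ht1 htn (by omega) ?_ ht2
      hdens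
    rw [le_div_iff₀ (by positivity)]
    rw [div_le_iff₀ hc0] at h3
    linarith
  · exact hasIncomparableFamily_of_lt_sq_mul_cube hc0 hc1 hk hck hV h2 ht1 htn h4 ht2 hdens
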